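/- Let $m\ge 1$ be an integer. An *$x$-monotone lattice path* from $\{x=0\}$ to $\{x=m\}$ is a finite lattice path in $\mathbb Z^2$ that starts at a point $(0,a)$, ends at a point $(m,b)$, and has all its steps in $\{(1,0),(0,1),(0,-1)\}$. Let $\eta_-$ and $\eta_+$ be two such paths, with $\eta_-$ weakly below $\eta_+$: over each interval $[i,i+1]$, $0\le i<m$, the horizontal edge of $\eta_-$ is not above that of $\eta_+$, and on each line $x=i$, $0\le i\le m$, no vertex of $\eta_-$ lies above all vertices of $\eta_+$ and no vertex of $\eta_+$ lies below all vertices of $\eta_-$. Let $\Gamma$ be the closed (simply connected) region between $\eta_-$ and $\eta_+$ in the strip $0\le x\le m$: a lattice point $(i,j)$ belongs to $\Gamma$ if $a\le j\le b$ for some vertices $(i,a)$ of $\eta_-$ and $(i,b)$ of $\eta_+$; a vertical unit edge lies in $\Gamma$ if both its ends do; the horizontal unit edge from $(i,j)$ to $(i+1,j)$ lies in $\Gamma$ if it lies weakly above the edge of $\eta_-$ and weakly below the edge of $\eta_+$ over $[i,i+1]$. Let $\alpha=\Gamma\cap\{x=0\}$ and $\beta=\Gamma\cap\{x=m\}$ be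 the vertical sides of $\Gamma$, and assume that the origin $O=(0,0)$ lies in $\alpha$. For $(i,j)\in\Gamma$ let $$\mathbf P[(i,j)\to(i\pm1,j)]=\pi_\pm(i,j),\qquad \mathbf P[(i,j)\to(i,j\pm1)]=\omega_\pm(i,j)$$ be nonnegative transition probabilities with $\pi_+(i,j)+\pi_-(i,j)+\omega_+(i,j)+\omega_-(i,j)=1$, and suppose that they are $y$-invariant, i.e. $\pi_\pm(i,j)=\pi_\pm(i,j')$ and $\omega_\pm(i,j)=\omega_\pm(i,j')$ for all $(i,j),(i,j')\in\Gamma$. Let $\{X_t\}$ be the lattice random walk that starts at $X_0=O$, moves according to these transition probabilities, and is absorbed (killed) as soon as it tries to leave $\Gamma$, that is, to make a step that is not along a unit edge lying in $\Gamma$. Let $T$ be the first time $t$ such that $X_t\in\beta$, and let $p(k)$ be the probability that $T<\infty$ and $X_T=(m,k)$. Then $\{p(k)\}$ is log-concave: $$p(k)^2\ \ge\ p(k+1)\,p(k-1)\qquad\text{for all } k\in\mathbb Z \text{ such that } (m,k+1)\in\beta \text{ and } (m,k-1)\in\beta.$$ -/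

import Mathlib

namespace LatticeExit

/-- An `x`-monotone lattice path from the line `x = 0` to the line `x = m`, given by the list of its
vertices: every step is `(1,0)`, `(0,1)` or `(0,-1)`. Vertical backtracking is allowed. -/
def IsXMonotonePath (m : ℤ) (η : List (ℤ × ℤ)) : Prop :=
  η.IsChain (fun p q => q = p + (1, 0) ∨ q = p + (0, 1) ∨ q = p + (0, -1)) ∧
    (∃ a, η.head? = some (0, a)) ∧ (∃ b, η.getLast? = some (m, b))

/-- The path `η` contains the horizontal unit edge from `(i, a)` to `(i + 1, a)`. -/
def HasHEdge (η : List (ℤ × ℤ)) (i a : ℤ) : Prop :=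
  [(i, a), (i + 1, a)] <:+: η

/-- A lattice region between the lines `x = 0` and `x = m`, bounded from below and from above by
two `x`-monotone lattice paths. The lower path runs (weakly) below the upper one: over every unit
interval `[i, i + 1]` the horizontal edge of `lower` is not above that of `upper`, and over every
integer abscissa no vertex of `lower` is above all of `upper`, no vertex of `upper` below all of
`lower`. -/
structure Region (m : ℤ) where
  lower : List (ℤ × ℤ)
  upper : List (ℤ × ℤ)
  lower_path : IsXMonotonePath m lower
  upper_path : IsXMonotonePath m upper
  edge_le : ∀ i a b, HasHEdge lower i a → HasHEdge upper i b → a ≤ b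
  lower_le : ∀ i a, (i, a) ∈ lower → ∃ b, (i, b) ∈ upper ∧ a ≤ b
  le_upper : ∀ i b, (i, b) ∈ upper → ∃ a, (i, a) ∈ lower ∧ a ≤ b

namespace Region

variable {m : ℤ} (Γ : Region m)

/-- The lattice points of the closed region: those between the two boundary paths. -/
def points : Set (ℤ × ℤ) :=
  {p | ∃ a b, (p.1, a) ∈ Γ.lower ∧ (p.1, b) ∈ Γ.upper ∧ a ≤ p.2 ∧ p.2 ≤ b}

/-- The horizontal unit edge from `(i, j)` to `(i + 1, j)` lies in the closed region. -/
def ContainsHEdge (i j : ℤ) : Prop :=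
  ∃ a b, HasHEdge Γ.lower i a ∧ HasHEdge Γ.upper i b ∧ a ≤ j ∧ j ≤ b

/-- `p` and `q` are joined by a unit lattice edge contained in the closed region. A vertical unit
edge lies in the region as soon as its two ends do. -/
def Adj (p q : ℤ × ℤ) : Prop :=
  (p ∈ Γ.points ∧ q ∈ Γ.points ∧ p.1 = q.1 ∧ (q.2 = p.2 + 1 ∨ p.2 = q.2 + 1)) ∨
    (p.2 = q.2 ∧ q.1 = p.1 + 1 ∧ Γ.ContainsHEdge p.1 p.2) ∨
    (p.2 = q.2 ∧ p.1 = q.1 + 1 ∧ Γ.ContainsHEdge q.1 q.2)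

/-- The left side `α`. -/
def left : Set (ℤ × ℤ) := {p | p ∈ Γ.points ∧ p.1 = 0}

/-- The right side `β`. -/
def right : Set (ℤ × ℤ) := {p | p ∈ Γ.points ∧ p.1 = m}

end Region

/-- Nearest-neighbour weights: `πp i j`, `πm i j`, `ωp i j`, `ωm i j` are the weights of the steps
from `(i, j)` to `(i + 1, j)`, `(i - 1, j)`, `(i, j + 1)`, `(i, j - 1)`. -/
structure StepWeights where
  πp : ℤ → ℤ → ℝ
  πm : ℤ → ℤ → ℝ
  ωp : ℤ → ℤ → ℝ
  ωm : ℤ → ℤ → ℝ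

namespace StepWeights

variable (w : StepWeights) {m : ℤ} (Γ : Region m)

/-- The weights are transition probabilities at all points of the region. -/
def IsTransition : Prop :=
  ∀ i j, (i, j) ∈ Γ.points →
    0 ≤ w.πp i j ∧ 0 ≤ w.πm i j ∧ 0 ≤ w.ωp i j ∧ 0 ≤ w.ωm i j ∧
      w.πp i j + w.πm i j + w.ωp i j + w.ωm i j = 1

/-- The weights are invariant under vertical shifts (inside the region). -/
def YInvariant : Prop :=
  ∀ i j j', (i, j) ∈ Γ.points → (i, j') ∈ Γ.points →
    w.πp i j = w.πp i j' ∧ w.πm i j = w.πm i j' ∧ w.ωp i j = w.ωp i j' ∧ w.ωm i j = w.ωm i j'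

/-- The weight of the step from `p` to `q`. -/
def step (p q : ℤ × ℤ) : ℝ :=
  if q = (p.1 + 1, p.2) then w.πp p.1 p.2
  else if q = (p.1 - 1, p.2) then w.πm p.1 p.2
  else if q = (p.1, p.2 + 1) then w.ωp p.1 p.2
  else if q = (p.1, p.2 - 1) then w.ωm p.1 p.2
  else 0

/-- The four lattice neighbours of a point. -/
def neighbors (p : ℤ × ℤ) : Finset (ℤ × ℤ) :=
  {(p.1 + 1, p.2), (p.1 - 1, p.2), (p.1, p.2 + 1), (p.1, p.2 - 1)}

open Classical in
/-- The transition matrix of the walk absorbed on leaving the region. The state `none` is the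
absorbing state, entered when the walk attempts a step that is not along an edge of the region. -/
noncomputable def kernel : Option (ℤ × ℤ) → Option (ℤ × ℤ) → ℝ
  | some p, some q => if Γ.Adj p q then w.step p q else 0
  | some p, none => ∑ q ∈ neighbors p, if Γ.Adj p q then 0 else w.step p q
  | none, some _ => 0
  | none, none => 1

end StepWeights

open MeasureTheory in
/-- `X` is the Markov chain started at the origin that moves with the step weights `w` and is
absorbed on leaving `Γ`, described by its finite-dimensional distributions. -/
structure IsAbsorbedWalk {m : ℤ} (Γ : Region m) (w : StepWeights) {Ω : Type*} [MeasurableSpace Ω]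
    (μ : Measure Ω) (X : ℕ → Ω → Option (ℤ × ℤ)) : Prop where
  measurable : ∀ t s, MeasurableSet {ω | X t ω = s}
  law : ∀ (n : ℕ) (x : ℕ → Option (ℤ × ℤ)),
    μ.real {ω | ∀ t ≤ n, X t ω = x t} =
      (if x 0 = some (0, 0) then 1 else 0) * ∏ t ∈ Finset.range n, w.kernel Γ (x t) (x (t + 1))

/-- `T` is the first time at which the trajectory `x` is on the right side `β`. -/
def IsFirstHit {m : ℤ} (Γ : Region m) (x : ℕ → Option (ℤ × ℤ)) (T : ℕ) : Prop :=
  IsLeast {t | ∃ q ∈ Γ.right, x t = some q} T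

open MeasureTheory in
/-- The exit probability `p(k)`: the probability that the right side `β` is reached and that the
point at which it is first reached is `(m, k)`. -/
noncomputable def exitProb {m : ℤ} (Γ : Region m) {Ω : Type*} [MeasurableSpace Ω]
    (μ : Measure Ω) (X : ℕ → Ω → Option (ℤ × ℤ)) (k : ℤ) : ℝ :=
  μ.real {ω | ∃ T, IsFirstHit Γ (fun t => X t ω) T ∧ X T ω = some (m, k)}

end LatticeExit

/-!
Walks that survive each step only with probability `r < 1` have exit probabilities `p(k)` that
converge to the required ones as `r → 1` (Abel's theorem, `IsAbsorbedWalk.tendsto_discountedHit`),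
so it suffices to treat a fixed `r < 1`. As functions of the starting point `x`, the exit
probabilities `H(x, k)` are then discounted harmonic: they satisfy a strict maximum principle, by
which every point where such a function is positive is joined to the right side by a path on which
it is positive (`IsDiscountedHarmonic.exists_reach_pos`).

Suppose `p(k)² < p(k + 1) p(k - 1)`. Put `a = p(k) + p(k - 1)` and `b = p(k + 1) + p(k)`, let
`f = a H(·, k + 1) - b H(·, k)` on `Γ`, and let `g` be the translate by `(0, 1)` of
`a H(·, k) - b H(·, k - 1)`, a function on the translate `Γ'` of `Γ`. On the right side both have
the value `a` at `(m, k + 1)`, `-b` at `(m, k)` and `0` elsewhere, while `f(0, 0) > 0 > g(0, 1)`.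

* A path on which `f > 0` leads from `(0, 0)` to `(m, k + 1)`. A point at the top of `Γ` with
  `f < 0` would be joined to `(m, k)` by a path disjoint from this one, which is impossible in the
  plane. So `f ≥ 0` at the top of `Γ`, and likewise `g ≤ 0` at the bottom of `Γ'`.
* Consequently `f`, extended by zero, is subharmonic and `g` superharmonic for the walk on the union
  of `Γ` and `Γ'`. The step probabilities on the union are well defined by `y`-invariance. As `f`
  and `g` agree on the right side, `f ≤ g` (`IsDiscountedHarmonic.le_of_boundary`).
* Now the path from `(0, 0)` to `(m, k + 1)` with `f > 0` and the path from `(0, 1)` to `(m, k)`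
  with `g < 0` are disjoint; but such paths cross (`IsDiscountedHarmonic.not_pos_neg`).

The topological input is `StripGraph.not_disjoint_of_above`. It is proved without the Jordan curve
theorem: the signed number of horizontal steps of a path that pass above a point is constant as the
point moves along a path disjoint from the first one.
-/

namespace LatticeExit

/-! ### Graphs in a strip and crossing paths -/

/-- A subgraph of the square lattice contained in the strip `0 ≤ x ≤ m`. A vertical edge belongs to
the graph as soon as its ends do; `K i j` says that the horizontal edge from `(i, j)` to
`(i + 1, j)` does. -/
structure StripGraph (m : ℤ) where
  V : Set (ℤ × ℤ)
  K : ℤ → ℤ → Prop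
  strip : ∀ p ∈ V, 0 ≤ p.1 ∧ p.1 ≤ m
  left_mem : ∀ i j, K i j → (i, j) ∈ V
  right_mem : ∀ i j, K i j → (i + 1, j) ∈ V

namespace StripGraph

variable {m : ℤ} (G G' : StripGraph m)

/-- Adjacency, in the form used by `Region.Adj`. -/
def Adj (p q : ℤ × ℤ) : Prop :=
  (p ∈ G.V ∧ q ∈ G.V ∧ p.1 = q.1 ∧ (q.2 = p.2 + 1 ∨ p.2 = q.2 + 1)) ∨
    (p.2 = q.2 ∧ q.1 = p.1 + 1 ∧ G.K p.1 p.2) ∨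
    (p.2 = q.2 ∧ p.1 = q.1 + 1 ∧ G.K q.1 q.2)

variable {G G'}

lemma Adj.mem_left {p q : ℤ × ℤ} (h : G.Adj p q) : p ∈ G.V := by
  obtain ⟨x, y⟩ := p
  obtain ⟨x', y'⟩ := q
  rcases h with h | ⟨h1, h2, h3⟩ | ⟨h1, h2, h3⟩
  · exact h.1
  · exact G.left_mem _ _ h3
  · simp only at h1 h2 h3
    subst h1 h2
    exact G.right_mem _ _ h3

lemma Adj.symm {p q : ℤ × ℤ} (h : G.Adj p q) : G.Adj q p := by
  rcases h with ⟨h1, h2, h3, h4⟩ | ⟨h1, h2, h3⟩ | ⟨h1, h2, h3⟩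
  · exact Or.inl ⟨h2, h1, h3.symm, h4.symm⟩
  · exact Or.inr (Or.inr ⟨h1.symm, h2, h3⟩)
  · exact Or.inr (Or.inl ⟨h1.symm, h2, h3⟩)

lemma Adj.mem_right {p q : ℤ × ℤ} (h : G.Adj p q) : q ∈ G.V := h.symm.mem_left

lemma Adj.mem_neighbors {p q : ℤ × ℤ} (h : G.Adj p q) : q ∈ StepWeights.neighbors p := by
  obtain ⟨x, y⟩ := p
  obtain ⟨x', y'⟩ := q
  simp only [StepWeights.neighbors, Finset.mem_insert, Finset.mem_singleton, Prod.mk.injEq]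
  rcases h with ⟨_, _, h3, h4⟩ | ⟨h1, h2, _⟩ | ⟨h1, h2, _⟩
  all_goals simp only at *
  all_goals omega

variable (G) in
/-- The image of the graph under the translation by `(0, 1)`. -/
def shift : StripGraph m where
  V := {p | (p.1, p.2 - 1) ∈ G.V}
  K i j := G.K i (j - 1)
  strip p hp := G.strip (p.1, p.2 - 1) hp
  left_mem i j h := G.left_mem i (j - 1) h
  right_mem i j h := G.right_mem i (j - 1) h

lemma shift_adj {p q : ℤ × ℤ} :
    G.shift.Adj p q ↔ G.Adj (p.1, p.2 - 1) (q.1, q.2 - 1) := by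
  simp only [Adj, shift, Set.mem_ofPred_eq]
  have h1 : (q.2 = p.2 + 1 ∨ p.2 = q.2 + 1) ↔
      (q.2 - 1 = p.2 - 1 + 1 ∨ p.2 - 1 = q.2 - 1 + 1) := by omega
  have h2 : p.2 = q.2 ↔ p.2 - 1 = q.2 - 1 := by omega
  rw [h1, h2]

variable (G) in
/-- The image of the graph under the reflection `(x, y) ↦ (x, -y)`. -/
def reflect : StripGraph m where
  V := {p | (p.1, -p.2) ∈ G.V}
  K i j := G.K i (-j)
  strip p hp := G.strip (p.1, -p.2) hp
  left_mem i j h := G.left_mem i (-j) h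
  right_mem i j h := G.right_mem i (-j) h

lemma Adj.reflect {p q : ℤ × ℤ} (h : G.Adj p q) :
    G.reflect.Adj (p.1, -p.2) (q.1, -q.2) := by
  simp only [Adj, StripGraph.reflect, Set.mem_ofPred_eq, neg_neg, Prod.mk.eta, neg_inj]
  rcases h with ⟨h1, h2, h3, h4⟩ | h | h
  · exact Or.inl ⟨h1, h2, h3, by omega⟩
  · exact Or.inr (Or.inl h)
  · exact Or.inr (Or.inr h)

variable (G) in
/-- Reachability by a path of `G` all of whose vertices (apart from the start of a constant path)
lie in `S`. -/
def Reach (S : Set (ℤ × ℤ)) : ℤ × ℤ → ℤ × ℤ → Prop :=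
  Relation.ReflTransGen fun a b => a ∈ S ∧ b ∈ S ∧ G.Adj a b

/-- For a path from `p` to `q`, let `A i j` be the number of its horizontal steps over `[i, i + 1]`
strictly above height `j`, steps to the left counted negatively. If the path avoids `(i, j)`, it
enters or leaves the open half-line above `(i, j)` by horizontal steps only, so that `A (i - 1) j`
and `A i j` differ by the contribution of the endpoints. -/
lemma Reach.exists_flow {S : Set (ℤ × ℤ)} {p q : ℤ × ℤ} (h : G.Reach S p q) :
    ∃ A : ℤ → ℤ → ℤ,
      (∀ i j, (i, j) ∉ S → A (i - 1) j + (if p.1 = i ∧ j < p.2 then 1 else 0) =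
        A i j + (if q.1 = i ∧ j < q.2 then 1 else 0)) ∧
      (∀ i j, (i, j + 1) ∉ S → A i (j + 1) = A i j) ∧
      (∀ i j, (∀ j', j < j' → ¬ G.K i j') → A i j = 0) := by
  induction h with
  | refl => exact ⟨fun _ _ => 0, by simp, by simp, by simp⟩
  | @tail b c _ hbc ih =>
    obtain ⟨A, h1, h2, h3⟩ := ih
    obtain ⟨hb, hc, hadj⟩ := hbc
    obtain ⟨x, y⟩ := b
    obtain ⟨x', y'⟩ := c
    refine ⟨fun i j => A i j + (if x' = x + 1 ∧ x = i ∧ j < y then 1 else 0) -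
      (if x = x' + 1 ∧ x' = i ∧ j < y then 1 else 0), ?_, ?_, ?_⟩
    · intro i j hij
      have hb' : ¬ (x = i ∧ y = j) := by rintro ⟨rfl, rfl⟩; exact hij hb
      have hc' : ¬ (x' = i ∧ y' = j) := by rintro ⟨rfl, rfl⟩; exact hij hc
      have := h1 i j hij
      rcases hadj with ⟨_, _, h, h'⟩ | ⟨h, h', _⟩ | ⟨h, h', _⟩ <;> simp only at * <;>
        split_ifs at this ⊢ <;> omega
    · intro i j hij
      have hb' : ¬ (x = i ∧ y = j + 1) := by rintro ⟨rfl, rfl⟩; exact hij hb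
      have hc' : ¬ (x' = i ∧ y' = j + 1) := by rintro ⟨rfl, rfl⟩; exact hij hc
      have := h2 i j hij
      rcases hadj with ⟨_, _, h, h'⟩ | ⟨h, h', _⟩ | ⟨h, h', _⟩ <;> simp only at * <;>
        split_ifs at this ⊢ <;> omega
    · intro i j hij
      have := h3 i j hij
      rcases hadj with ⟨_, _, h, h'⟩ | ⟨h, h', hK⟩ | ⟨h, h', hK⟩ <;> simp only at *
      · split_ifs at this ⊢ <;> omega
      · have : ¬ (x = i ∧ j < y) := by rintro ⟨rfl, h⟩; exact hij _ h hK
        split_ifs at this ⊢ <;> omega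
      · have : ¬ (x' = i ∧ j < y) := by rintro ⟨rfl, h''⟩; exact hij _ (h ▸ h'') hK
        split_ifs at this ⊢ <;> omega

/-- A path of `G` from the left side to `(m, b)` and a path to `(m, b')`, `b' < b`, which
starts above it cannot be disjoint. The start `z` is above the first path if it is on the left side
and not below its start, or if `G` has no horizontal edge over one of the two unit intervals
at `z` that is strictly higher than `z`. -/
lemma not_disjoint_of_above {S N : Set (ℤ × ℤ)} (hSN : Disjoint S N) (hm : 0 < m) {a b b' : ℤ}
    (hp : G.Reach S (0, a) (m, b)) {z : ℤ × ℤ} (hzN : z ∈ N) (hz : G'.Reach N z (m, b'))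
    (hb : b' < b)
    (habove : (z.1 = 0 ∧ a ≤ z.2) ∨ (z.1 < m ∧ ∀ j, z.2 < j → ¬ G.K z.1 j) ∨
      (0 < z.1 ∧ ∀ j, z.2 < j → ¬ G.K (z.1 - 1) j)) : False := by
  obtain ⟨A, h1, h2, h3⟩ := hp.exists_flow
  have hN : ∀ q ∈ N, q ∉ S := fun q hq hq' => Set.disjoint_left.1 hSN hq' hq
  have hA0 : ∀ j, A (0 - 1) j = 0 := fun j => h3 _ _ fun j' _ hK => by
    have := (G.strip _ (G.left_mem _ _ hK)).1
    simp at this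
  have hAm : ∀ j, A m j = 0 := fun j => h3 _ _ fun j' _ hK => by
    have := (G.strip _ (G.right_mem _ _ hK)).2
    simp at this
  have hqS : (m, b) ∈ S := by
    rcases Relation.ReflTransGen.cases_tail hp with h | ⟨_, _, h⟩
    · simp only [Prod.mk.injEq] at h
      omega
    · exact h.2.1
  -- The quantity that is constant along paths avoiding the first one: the crossings above a point,
  -- with the end of the first path counted as a crossing to the right of the strip.
  have key : ∀ q, G'.Reach N z q → A q.1 q.2 + (if m = q.1 ∧ q.2 < b then 1 else 0) =
      A z.1 z.2 + (if m = z.1 ∧ z.2 < b then 1 else 0) := by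
    intro q hq
    induction hq with
    | refl => rfl
    | @tail c d _ hcd ih =>
      rw [← ih]
      obtain ⟨hc, hd, hadj⟩ := hcd
      have hc1 := G'.strip _ hadj.mem_left
      have hd1 := G'.strip _ hadj.mem_right
      have hcS := hN _ hc
      have hdS := hN _ hd
      obtain ⟨x, y⟩ := c
      obtain ⟨x', y'⟩ := d
      have hc2 := h1 _ _ hcS
      have hd2 := h1 _ _ hdS
      rcases hadj with ⟨_, _, h, h' | h'⟩ | ⟨h, h', _⟩ | ⟨h, h', _⟩ <;> simp only at * <;>
        subst h h'
      · have := h2 _ _ hdS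
        have hmb : m = x → y + 1 ≠ b := by rintro rfl rfl; exact hdS hqS
        split_ifs <;> omega
      · have := h2 _ _ hcS
        have hmb : m = x → y' + 1 ≠ b := by rintro rfl rfl; exact hcS hqS
        split_ifs <;> omega
      · rw [add_sub_cancel_right] at hd2
        split_ifs at * <;> omega
      · rw [add_sub_cancel_right] at hc2
        split_ifs at * <;> omega
  have hend := key _ hz
  have hzS := h1 _ _ (hN z hzN)
  simp only [hAm, true_and, if_pos hb] at hend
  rcases habove with ⟨h, h'⟩ | ⟨h, h'⟩ | ⟨h, h'⟩
  · rw [h] at hzS hend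
    rw [hA0] at hzS
    split_ifs at * <;> simp only at * <;> omega
  · rw [h3 _ _ h'] at hend
    split_ifs at * <;> omega
  · rw [h3 _ _ h'] at hzS
    split_ifs at * <;> simp only at * <;> omega

lemma Reach.reflect {S : Set (ℤ × ℤ)} {p q : ℤ × ℤ} (h : G.Reach S p q) :
    G.reflect.Reach {x | (x.1, -x.2) ∈ S} (p.1, -p.2) (q.1, -q.2) :=
  Relation.ReflTransGen.lift (fun x : ℤ × ℤ => (x.1, -x.2))
    (fun a b hab => ⟨by simpa using hab.1, by simpa using hab.2.1, hab.2.2.reflect⟩) _ _ h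

/-- The mirror image of `not_disjoint_of_above`. -/
lemma not_disjoint_of_below {S N : Set (ℤ × ℤ)} (hSN : Disjoint S N) (hm : 0 < m) {a b b' : ℤ}
    (hp : G.Reach S (0, a) (m, b)) {z : ℤ × ℤ} (hzN : z ∈ N) (hz : G'.Reach N z (m, b'))
    (hb : b < b')
    (hbelow : (z.1 < m ∧ ∀ j, j < z.2 → ¬ G.K z.1 j) ∨
      (0 < z.1 ∧ ∀ j, j < z.2 → ¬ G.K (z.1 - 1) j)) : False := by
  refine not_disjoint_of_above (S := {x | (x.1, -x.2) ∈ S}) (N := {x | (x.1, -x.2) ∈ N})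
    (Set.disjoint_left.2 fun x hx hx' => Set.disjoint_left.1 hSN hx hx') hm hp.reflect
    (by simpa using hzN) hz.reflect (by simpa using hb) (Or.inr ?_)
  refine hbelow.imp ?_ ?_ <;>
  · rintro ⟨h, h'⟩
    exact ⟨h, fun j hj => h' (-j) (by simp only at hj; omega)⟩

end StripGraph

/-! ### Discounted harmonic functions and the maximum principle -/

/-- A maximum principle: if every upper bound `M ≥ 0` of `g` on `C` improves to `r * M` with a
fixed `r < 1`, then `g ≤ 0` on `C`. -/
lemma nonpos_of_contraction {α : Type*} {g : α → ℝ} {C : Set α} {r B : ℝ} (hr : 0 ≤ r)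
    (hr1 : r < 1) (hB : ∀ x ∈ C, g x ≤ B)
    (h : ∀ M, 0 ≤ M → (∀ y ∈ C, g y ≤ M) → ∀ x ∈ C, g x ≤ r * M) : ∀ x ∈ C, g x ≤ 0 := by
  have key : ∀ n : ℕ, ∀ x ∈ C, g x ≤ r ^ n * |B| := by
    intro n
    induction n with
    | zero => intro x hx; simpa using (hB x hx).trans (le_abs_self B)
    | succ n ih =>
      intro x hx
      have := h _ (by positivity) ih x hx
      rwa [pow_succ', mul_assoc]
  intro x hx
  have hlim := (tendsto_pow_atTop_nhds_zero_of_lt_one hr hr1).mul_const |B|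
  rw [zero_mul] at hlim
  exact ge_of_tendsto' hlim fun n => key n x hx

open Classical in
/-- `f` is a bounded function supported on `G` that is harmonic off the line `x = m` for the walk
with step probabilities `U` that is killed on attempting a step not along an edge of `G`, and
survives each step with probability `r` only. -/
structure IsDiscountedHarmonic {m : ℤ} (G : StripGraph m) (U : ℤ × ℤ → ℤ × ℤ → ℝ) (r : ℝ)
    (f : ℤ × ℤ → ℝ) : Prop where
  bdd : ∃ B, ∀ x, |f x| ≤ B
  supp : ∀ x ∉ G.V, f x = 0
  eq : ∀ x, x.1 ≠ m →
    f x = r * ∑ y ∈ StepWeights.neighbors x, (if G.Adj x y then U x y else 0) * f y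

namespace IsDiscountedHarmonic

variable {m : ℤ} {G G' : StripGraph m} {U : ℤ × ℤ → ℤ × ℤ → ℝ} {r : ℝ} {f g : ℤ × ℤ → ℝ}

lemma neg (hf : IsDiscountedHarmonic G U r f) : IsDiscountedHarmonic G U r (fun x => -f x) where
  bdd := by simpa using hf.bdd
  supp x hx := by simp [hf.supp x hx]
  eq x hx := by simp [hf.eq x hx]

lemma linComb (hf : IsDiscountedHarmonic G U r f) (hg : IsDiscountedHarmonic G U r g) (a b : ℝ) :
    IsDiscountedHarmonic G U r (fun x => a * f x - b * g x) where
  bdd := by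
    obtain ⟨B, hB⟩ := hf.bdd
    obtain ⟨B', hB'⟩ := hg.bdd
    refine ⟨|a| * B + |b| * B', fun x => (abs_sub _ _).trans ?_⟩
    rw [abs_mul, abs_mul]
    gcongr
    exacts [hB x, hB' x]
  supp x hx := by simp [hf.supp x hx, hg.supp x hx]
  eq x hx := by
    rw [hf.eq x hx, hg.eq x hx, mul_left_comm, mul_left_comm b, ← mul_sub, Finset.mul_sum,
      Finset.mul_sum, ← Finset.sum_sub_distrib]
    congr 1
    exact Finset.sum_congr rfl fun y _ => by ring

/-- From every point at which `f` is positive, a path through points of positivity leads to the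
line `x = m`. -/
lemma exists_reach_pos (hf : IsDiscountedHarmonic G U r f) (hr : 0 ≤ r) (hr1 : r < 1)
    (hU : ∀ x y, 0 ≤ U x y) (hU1 : ∀ x, ∑ y ∈ StepWeights.neighbors x, U x y ≤ 1)
    {u : ℤ × ℤ} (hu : 0 < f u) :
    ∃ j, 0 < f (m, j) ∧ G.Reach {x | 0 < f x} u (m, j) := by
  classical
  by_contra! hno
  obtain ⟨B, hB⟩ := hf.bdd
  refine (nonpos_of_contraction (g := f) (C := {x | 0 < f x ∧ G.Reach {x | 0 < f x} u x}) hr hr1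
    (fun x _ => (le_abs_self _).trans (hB x)) ?_ u ⟨hu, Relation.ReflTransGen.refl⟩).not_gt hu
  rintro M hM hbd x ⟨hx, hux⟩
  have hxm : x.1 ≠ m := by
    rintro h
    obtain ⟨x1, x2⟩ := x
    subst h
    exact hno _ hx hux
  rw [hf.eq x hxm]
  refine mul_le_mul_of_nonneg_left ?_ hr
  calc ∑ y ∈ StepWeights.neighbors x, (if G.Adj x y then U x y else 0) * f y
      ≤ ∑ y ∈ StepWeights.neighbors x, U x y * M := by
        refine Finset.sum_le_sum fun y _ => ?_
        split_ifs with hxy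
        · refine mul_le_mul_of_nonneg_left ?_ (hU x y)
          by_cases hy : 0 < f y
          · exact hbd y ⟨hy, Relation.ReflTransGen.tail hux ⟨hx, hy, hxy⟩⟩
          · exact (not_lt.1 hy).trans hM
        · rw [zero_mul]
          exact mul_nonneg (hU x y) hM
    _ ≤ M := by
        rw [← Finset.sum_mul]
        exact mul_le_of_le_one_left hM (hU1 x)

lemma exists_reach_neg (hf : IsDiscountedHarmonic G U r f) (hr : 0 ≤ r) (hr1 : r < 1)
    (hU : ∀ x y, 0 ≤ U x y) (hU1 : ∀ x, ∑ y ∈ StepWeights.neighbors x, U x y ≤ 1)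
    {u : ℤ × ℤ} (hu : f u < 0) :
    ∃ j, f (m, j) < 0 ∧ G.Reach {x | f x < 0} u (m, j) := by
  simpa using hf.neg.exists_reach_pos hr hr1 hU hU1 (u := u) (by simpa using hu)

lemma disjoint_pos_neg (h : ∀ x, f x ≤ g x) : Disjoint {x | 0 < f x} {x | g x < 0} :=
  Set.disjoint_left.2 fun x hx hx' => (hx.trans_le (h x)).not_gt hx'

/-- If `f` is positive at a point of the left side and its only positive value on the line `x = m`
is above its only negative one, then it is nonnegative along the top of the graph. -/
lemma nonneg_of_top (hf : IsDiscountedHarmonic G U r f) (hr : 0 ≤ r) (hr1 : r < 1)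
    (hU : ∀ x y, 0 ≤ U x y) (hU1 : ∀ x, ∑ y ∈ StepWeights.neighbors x, U x y ≤ 1) (hm : 0 < m)
    {a b b' : ℤ} (hb : b' < b) (ha : 0 < f (0, a)) (hpos : ∀ j, 0 < f (m, j) → j = b)
    (hneg : ∀ j, f (m, j) < 0 → j = b') {z : ℤ × ℤ}
    (hz : (z.1 < m ∧ ∀ j, z.2 < j → ¬ G.K z.1 j) ∨
      (0 < z.1 ∧ ∀ j, z.2 < j → ¬ G.K (z.1 - 1) j)) : 0 ≤ f z := by
  by_contra! hzn
  obtain ⟨j, hj, hp⟩ := hf.exists_reach_pos hr hr1 hU hU1 ha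
  obtain ⟨j', hj', hq⟩ := hf.exists_reach_neg hr hr1 hU hU1 hzn
  rw [hpos j hj] at hp
  rw [hneg j' hj'] at hq
  exact StripGraph.not_disjoint_of_above (disjoint_pos_neg fun _ => le_rfl) hm hp hzn hq hb
    (Or.inr hz)

/-- The mirror image of `nonneg_of_top`. -/
lemma nonpos_of_bottom (hf : IsDiscountedHarmonic G U r f) (hr : 0 ≤ r) (hr1 : r < 1)
    (hU : ∀ x y, 0 ≤ U x y) (hU1 : ∀ x, ∑ y ∈ StepWeights.neighbors x, U x y ≤ 1) (hm : 0 < m)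
    {a b b' : ℤ} (hb : b' < b) (ha : f (0, a) < 0) (hpos : ∀ j, 0 < f (m, j) → j = b)
    (hneg : ∀ j, f (m, j) < 0 → j = b') {z : ℤ × ℤ}
    (hz : (z.1 < m ∧ ∀ j, j < z.2 → ¬ G.K z.1 j) ∨
      (0 < z.1 ∧ ∀ j, j < z.2 → ¬ G.K (z.1 - 1) j)) : f z ≤ 0 := by
  by_contra! hzn
  obtain ⟨j, hj, hp⟩ := hf.exists_reach_neg hr hr1 hU hU1 ha
  obtain ⟨j', hj', hq⟩ := hf.exists_reach_pos hr hr1 hU hU1 hzn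
  rw [hneg j hj] at hp
  rw [hpos j' hj'] at hq
  exact StripGraph.not_disjoint_of_below (disjoint_pos_neg fun _ => le_rfl).symm hm hp hzn hq hb hz

/-- Enlarging the graph `G` to `G ∪ G'` can only increase `f` when `f ≥ 0` where edges are added,
and enlarging `G'` can only decrease `g` when `g ≤ 0` where edges are added. Functions with the same
values on the line `x = m` are then ordered. -/
lemma le_of_boundary (hf : IsDiscountedHarmonic G U r f) (hg : IsDiscountedHarmonic G' U r g)
    (hr : 0 ≤ r) (hr1 : r < 1) (hU : ∀ x y, 0 ≤ U x y)
    (hU1 : ∀ x, ∑ y ∈ StepWeights.neighbors x, U x y ≤ 1) (hfg : ∀ j, f (m, j) = g (m, j))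
    (hf0 : ∀ x y, G'.Adj x y → ¬ G.Adj x y → 0 ≤ f y)
    (hg0 : ∀ x y, G.Adj x y → ¬ G'.Adj x y → g y ≤ 0) (x : ℤ × ℤ) : f x ≤ g x := by
  classical
  obtain ⟨B, hB⟩ := hf.bdd
  obtain ⟨B', hB'⟩ := hg.bdd
  suffices h : ∀ x ∈ Set.univ, f x - g x ≤ 0 from sub_nonpos.1 (h x trivial)
  refine nonpos_of_contraction (g := fun x => f x - g x) (B := B + B') hr hr1 ?_ ?_
  · intro x _
    have h1 := abs_le.1 (hB x)
    have h2 := abs_le.1 (hB' x)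
    linarith
  · intro M hM hbd x _
    by_cases hx : x.1 = m
    · obtain ⟨x1, x2⟩ := x
      simp only at hx
      subst hx
      simp only [hfg, sub_self]
      positivity
    · rw [hf.eq x hx, hg.eq x hx, ← mul_sub, ← Finset.sum_sub_distrib]
      refine mul_le_mul_of_nonneg_left ?_ hr
      calc _ ≤ ∑ y ∈ StepWeights.neighbors x, U x y * M := by
            refine Finset.sum_le_sum fun y _ => ?_
            have hM' := mul_le_mul_of_nonneg_left (hbd y trivial) (hU x y)
            have hM0 := mul_nonneg (hU x y) hM
            rw [mul_sub] at hM'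
            split_ifs with h1 h2 h2
            · linarith
            · have := mul_nonpos_of_nonneg_of_nonpos (hU x y) (hg0 x y h1 h2)
              linarith
            · have := mul_nonneg (hU x y) (hf0 x y h2 h1)
              linarith
            · linarith
        _ ≤ M := by
            rw [← Finset.sum_mul]
            exact mul_le_of_le_one_left hM (hU1 x)

end IsDiscountedHarmonic

namespace StripGraph

variable {m : ℤ} {G : StripGraph m}

/-- If the vertices on vertical lines and the horizontal edges over unit intervals form intervals,
an edge that is in the shifted graph but not in `G` starts at the top of `G`. -/
lemma top_of_shift_adj (hm : 0 < m)
    (hV : ∀ i a b c, a ≤ b → b ≤ c → (i, a) ∈ G.V → (i, c) ∈ G.V → (i, b) ∈ G.V)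
    (hK : ∀ i a b c, a ≤ b → b ≤ c → G.K i a → G.K i c → G.K i b) {x y : ℤ × ℤ}
    (h' : G.shift.Adj x y) (h : ¬ G.Adj x y) (hy : y ∈ G.V) :
    (y.1 < m ∧ ∀ j, y.2 < j → ¬ G.K y.1 j) ∨ (0 < y.1 ∧ ∀ j, y.2 < j → ¬ G.K (y.1 - 1) j) := by
  have hx' : (x.1, x.2 - 1) ∈ G.V := h'.mem_left
  have hy1 := G.strip _ hy
  have hx1 := G.strip _ hx'
  obtain ⟨x1, x2⟩ := x
  obtain ⟨y1, y2⟩ := y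
  simp only at *
  rcases h' with ⟨_, _, h1, h2⟩ | ⟨h1, h2, h3⟩ | ⟨h1, h2, h3⟩ <;> simp only at h1 h2 <;> subst h1
  · have hx : (x1, x2) ∉ G.V := fun hx => h (Or.inl ⟨hx, hy, rfl, h2⟩)
    have hlt : x2 - 1 = y2 := by
      by_contra hne
      exact hx (hV x1 _ _ y2 (by omega) (by omega) hx' hy)
    have hno : ∀ j, y2 < j → (x1, j) ∉ G.V := fun j hj hj' =>
      hx (hV x1 _ _ j (by omega) (by omega) hx' hj')
    by_cases hxm : x1 < m
    · exact Or.inl ⟨hxm, fun j hj hK => hno j hj (G.left_mem _ _ hK)⟩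
    · exact Or.inr ⟨by omega, fun j hj hK => hno j hj (by simpa using G.right_mem _ _ hK)⟩
  · subst h2
    refine Or.inr ⟨by omega, fun j hj hj' => h (Or.inr (Or.inl ⟨rfl, rfl, ?_⟩))⟩
    rw [add_sub_cancel_right] at hj'
    exact hK _ (x2 - 1) _ j (by omega) (by omega) h3 hj'
  · subst h2
    refine Or.inl ⟨by omega, fun j hj hj' => h (Or.inr (Or.inr ⟨rfl, rfl, ?_⟩))⟩
    exact hK _ (x2 - 1) _ j (by omega) (by omega) h3 hj'

/-- An edge that is in `G` but not in the shifted graph starts at the bottom of the latter. -/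
lemma bottom_of_adj (hm : 0 < m)
    (hV : ∀ i a b c, a ≤ b → b ≤ c → (i, a) ∈ G.V → (i, c) ∈ G.V → (i, b) ∈ G.V)
    (hK : ∀ i a b c, a ≤ b → b ≤ c → G.K i a → G.K i c → G.K i b) {x y : ℤ × ℤ}
    (h' : G.Adj x y) (h : ¬ G.shift.Adj x y) (hy : y ∈ G.shift.V) :
    (y.1 < m ∧ ∀ j, j < y.2 → ¬ G.shift.K y.1 j) ∨
      (0 < y.1 ∧ ∀ j, j < y.2 → ¬ G.shift.K (y.1 - 1) j) := by
  have hx : x ∈ G.V := h'.mem_left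
  have hy' : (y.1, y.2 - 1) ∈ G.V := hy
  rw [shift_adj] at h
  have hy1 := G.strip _ hy'
  have hx1 := G.strip _ hx
  obtain ⟨x1, x2⟩ := x
  obtain ⟨y1, y2⟩ := y
  simp only [shift] at *
  rcases h' with ⟨_, _, h1, h2⟩ | ⟨h1, h2, h3⟩ | ⟨h1, h2, h3⟩ <;> simp only at h1 h2 <;> subst h1
  · have hx' : (x1, x2 - 1) ∉ G.V := fun hx => h (Or.inl ⟨hx, hy', rfl, by simp only; omega⟩)
    have hlt : x2 + 1 = y2 := by
      by_contra hne
      exact hx' (hV x1 _ _ _ (by omega) (by omega) hy' hx)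
    have hno : ∀ j, j < y2 → (x1, j - 1) ∉ G.V := fun j hj hj' =>
      hx' (hV x1 _ _ _ (by omega) (by omega) hj' hx)
    by_cases hxm : x1 < m
    · exact Or.inl ⟨hxm, fun j hj hK => hno j hj (G.left_mem _ _ hK)⟩
    · exact Or.inr ⟨by omega, fun j hj hK => hno j hj (by simpa using G.right_mem _ _ hK)⟩
  · subst h2
    refine Or.inr ⟨by omega, fun j hj hj' => h (Or.inr (Or.inl ⟨rfl, rfl, ?_⟩))⟩
    rw [add_sub_cancel_right] at hj'
    exact hK _ (j - 1) _ x2 (by omega) (by omega) hj' h3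
  · subst h2
    refine Or.inl ⟨by omega, fun j hj hj' => h (Or.inr (Or.inr ⟨rfl, rfl, ?_⟩))⟩
    exact hK _ (j - 1) _ x2 (by omega) (by omega) hj' h3

end StripGraph

namespace IsDiscountedHarmonic

variable {m : ℤ} {G : StripGraph m} {U : ℤ × ℤ → ℤ × ℤ → ℝ} {r : ℝ} {f g : ℤ × ℤ → ℝ}

/-- The comparison at the heart of the log-concavity: two functions, harmonic for the graph and
for its shift, with the same values on the line `x = m`, positive at one point only and negative at
one lower point only, cannot have the signs `f (0, a) > 0` and `g (0, a') < 0` with `a ≤ a'`. -/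
lemma not_pos_neg (hf : IsDiscountedHarmonic G U r f) (hg : IsDiscountedHarmonic G.shift U r g)
    (hV : ∀ i a b c, a ≤ b → b ≤ c → (i, a) ∈ G.V → (i, c) ∈ G.V → (i, b) ∈ G.V)
    (hK : ∀ i a b c, a ≤ b → b ≤ c → G.K i a → G.K i c → G.K i b)
    (hr : 0 ≤ r) (hr1 : r < 1) (hU : ∀ x y, 0 ≤ U x y)
    (hU1 : ∀ x, ∑ y ∈ StepWeights.neighbors x, U x y ≤ 1) (hm : 0 < m)
    (hfg : ∀ j, f (m, j) = g (m, j)) {b b' : ℤ} (hb : b' < b)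
    (hpos : ∀ j, 0 < f (m, j) → j = b) (hneg : ∀ j, f (m, j) < 0 → j = b')
    {a a' : ℤ} (haa : a ≤ a') (ha : 0 < f (0, a)) (ha' : g (0, a') < 0) : False := by
  -- Edges of one graph missing from the other start at the top of `G` or at the bottom of its
  -- shift, where the signs of `f` and `g` are known.
  have hle : ∀ x, f x ≤ g x := by
    refine hf.le_of_boundary hg hr hr1 hU hU1 hfg (fun x y h' h => ?_) (fun x y h h' => ?_)
    · by_cases hy : y ∈ G.V
      · exact hf.nonneg_of_top hr hr1 hU hU1 hm hb ha hpos hneg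
          (StripGraph.top_of_shift_adj hm hV hK h' h hy)
      · exact (hf.supp y hy).ge
    · by_cases hy : y ∈ G.shift.V
      · exact hg.nonpos_of_bottom hr hr1 hU hU1 hm hb ha' (by simpa only [← hfg] using hpos)
          (by simpa only [← hfg] using hneg) (StripGraph.bottom_of_adj hm hV hK h h' hy)
      · exact (hg.supp y hy).le
  obtain ⟨j, hj, hp⟩ := hf.exists_reach_pos hr hr1 hU hU1 ha
  obtain ⟨j', hj', hq⟩ := hg.exists_reach_neg hr hr1 hU hU1 ha'
  rw [hpos j hj] at hp
  rw [hneg j' (by rwa [hfg])] at hq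
  -- By `hle` the paths along which `f > 0` and `g < 0` are disjoint, although they have to cross.
  exact StripGraph.not_disjoint_of_above (disjoint_pos_neg hle) hm hp ha' hq hb (Or.inl ⟨rfl, haa⟩)

end IsDiscountedHarmonic

/-! ### Regions as graphs in a strip -/

/-- The abscissa is nondecreasing along an `x`-monotone path. -/
lemma IsXMonotonePath.mem_strip {m : ℤ} {η : List (ℤ × ℤ)} (h : IsXMonotonePath m η)
    {p : ℤ × ℤ} (hp : p ∈ η) : 0 ≤ p.1 ∧ p.1 ≤ m := by
  obtain ⟨hc, ⟨a, ha⟩, b, hb⟩ := h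
  have hpw : η.Pairwise (fun p q => p.1 ≤ q.1) := by
    have : IsTrans (ℤ × ℤ) (fun p q => p.1 ≤ q.1) := ⟨fun _ _ _ => le_trans⟩
    refine List.isChain_iff_pairwise.1 (hc.imp ?_)
    rintro p q (rfl | rfl | rfl) <;> simp
  constructor
  · obtain ⟨l, rfl⟩ := List.head?_eq_some_iff.1 ha
    rcases List.mem_cons.1 hp with rfl | hp
    · rfl
    · exact (List.pairwise_cons.1 hpw).1 p hp
  · obtain ⟨l, rfl⟩ := List.getLast?_eq_some_iff.1 hb
    rcases List.mem_append.1 hp with hp | hp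
    · exact (List.pairwise_append.1 hpw).2.2 p hp (m, b) (by simp)
    · rw [List.mem_singleton.1 hp]

lemma HasHEdge.left_mem {η : List (ℤ × ℤ)} {i a : ℤ} (h : HasHEdge η i a) : (i, a) ∈ η :=
  h.subset (by simp)

lemma HasHEdge.right_mem {η : List (ℤ × ℤ)} {i a : ℤ} (h : HasHEdge η i a) : (i + 1, a) ∈ η :=
  h.subset (by simp)

namespace Region

variable {m : ℤ} (Γ : Region m)

/-- The graph of all lattice points and unit edges contained in the region. -/
def toStripGraph : StripGraph m where
  V := Γ.points
  K := Γ.ContainsHEdge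
  strip := by
    rintro p ⟨a, _, ha, _⟩
    exact Γ.lower_path.mem_strip (p := (p.1, a)) ha
  left_mem := by
    rintro i j ⟨a, b, ha, hb, h⟩
    exact ⟨a, b, ha.left_mem, hb.left_mem, h⟩
  right_mem := by
    rintro i j ⟨a, b, ha, hb, h⟩
    exact ⟨a, b, ha.right_mem, hb.right_mem, h⟩

lemma toStripGraph_adj {p q : ℤ × ℤ} : Γ.toStripGraph.Adj p q ↔ Γ.Adj p q := Iff.rfl

lemma points_convex (i a b c : ℤ) (hab : a ≤ b) (hbc : b ≤ c) (ha : (i, a) ∈ Γ.points)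
    (hc : (i, c) ∈ Γ.points) : (i, b) ∈ Γ.points := by
  obtain ⟨l, _, hl, _, hla, _⟩ := ha
  obtain ⟨_, u, _, hu, _, hcu⟩ := hc
  exact ⟨l, u, hl, hu, hla.trans hab, hbc.trans hcu⟩

lemma containsHEdge_convex (i a b c : ℤ) (hab : a ≤ b) (hbc : b ≤ c) (ha : Γ.ContainsHEdge i a)
    (hc : Γ.ContainsHEdge i c) : Γ.ContainsHEdge i b := by
  obtain ⟨l, _, hl, _, hla, _⟩ := ha
  obtain ⟨_, u, _, hu, _, hcu⟩ := hc
  exact ⟨l, u, hl, hu, hla.trans hab, hbc.trans hcu⟩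

end Region

/-! ### Hitting probabilities at a given time -/

section Hitting

variable {m : ℤ} {Γ : Region m} {w : StepWeights} {k : ℤ}

lemma sum_step (x : ℤ × ℤ) : ∑ y ∈ StepWeights.neighbors x, w.step x y =
    w.πp x.1 x.2 + w.πm x.1 x.2 + w.ωp x.1 x.2 + w.ωm x.1 x.2 := by
  have h1 : ¬ x.1 + 1 = x.1 - 1 := by omega
  have h2 : ¬ x.1 - 1 = x.1 + 1 := by omega
  have h3 : ¬ x.2 + 1 = x.2 - 1 := by omega
  have h4 : ¬ x.2 - 1 = x.2 + 1 := by omega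
  rw [StepWeights.neighbors, Finset.sum_insert, Finset.sum_insert, Finset.sum_insert,
    Finset.sum_singleton]
  · simp [StepWeights.step, h2, h4]
    ring
  all_goals simp [h1, h3]

lemma step_nonneg (hw : w.IsTransition Γ) {x : ℤ × ℤ} (hx : x ∈ Γ.points) (y : ℤ × ℤ) :
    0 ≤ w.step x y := by
  have := hw x.1 x.2 hx
  unfold StepWeights.step
  split_ifs
  exacts [this.1, this.2.1, this.2.2.1, this.2.2.2.1, le_rfl]

lemma sum_step_eq_one (hw : w.IsTransition Γ) {x : ℤ × ℤ} (hx : x ∈ Γ.points) :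
    ∑ y ∈ StepWeights.neighbors x, w.step x y = 1 := by
  rw [sum_step]
  exact (hw x.1 x.2 hx).2.2.2.2

lemma sum_neighbors_shift (F : ℤ × ℤ → ℝ) (x : ℤ × ℤ) :
    ∑ y ∈ StepWeights.neighbors x, F (y.1, y.2 - 1) =
      ∑ y ∈ StepWeights.neighbors (x.1, x.2 - 1), F y := by
  refine Finset.sum_bij (fun y _ => (y.1, y.2 - 1)) ?_ ?_ ?_ fun _ _ => rfl
  · rintro ⟨y1, y2⟩ hy
    simp only [StepWeights.neighbors, Finset.mem_insert, Finset.mem_singleton,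
      Prod.mk.injEq] at *
    omega
  · rintro ⟨y1, y2⟩ _ ⟨z1, z2⟩ _ h
    simp only [Prod.mk.injEq] at *
    omega
  · rintro ⟨y1, y2⟩ hy
    refine ⟨(y1, y2 + 1), ?_, by simp⟩
    simp only [StepWeights.neighbors, Finset.mem_insert, Finset.mem_singleton,
      Prod.mk.injEq] at *
    omega

lemma step_shift (hinv : w.YInvariant Γ) {x : ℤ × ℤ} (hx : x ∈ Γ.points)
    (hx' : (x.1, x.2 - 1) ∈ Γ.points) (y : ℤ × ℤ) :
    w.step (x.1, x.2 - 1) (y.1, y.2 - 1) = w.step x y := by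
  obtain ⟨h1, h2, h3, h4⟩ := hinv x.1 _ _ hx' hx
  obtain ⟨x1, x2⟩ := x
  obtain ⟨y1, y2⟩ := y
  simp only at h1 h2 h3 h4
  simp only [StepWeights.step, h1, h2, h3, h4, Prod.mk.injEq]
  have e1 : y2 - 1 = x2 - 1 ↔ y2 = x2 := by omega
  have e2 : y2 - 1 = x2 - 1 + 1 ↔ y2 = x2 + 1 := by omega
  have e3 : y2 - 1 = x2 - 1 - 1 ↔ y2 = x2 - 1 := by omega
  simp only [e1, e2, e3]

open Classical in
variable (Γ w k) in
/-- The probability that the absorbed walk started at the given state first visits the right side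
at time `n`, and does so at `(m, k)`. -/
noncomputable def hitProb : ℕ → Option (ℤ × ℤ) → ℝ
  | 0, o => if o = some (m, k) then 1 else 0
  | n + 1, o => if ∃ q ∈ Γ.right, o = some q then 0 else ∑' y, w.kernel Γ o y * hitProb n y

lemma hitProb_none (n : ℕ) : hitProb Γ w k n none = 0 := by
  induction n with
  | zero => simp [hitProb]
  | succ n ih =>
    rw [hitProb, if_neg (by simp)]
    refine (tsum_congr fun y => ?_).trans tsum_zero
    cases y with
    | none => rw [ih, mul_zero]
    | some q => simp [StepWeights.kernel]

lemma kernel_of_not_adj {x y : ℤ × ℤ} (h : ¬ Γ.Adj x y) : w.kernel Γ (some x) (some y) = 0 := by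
  simp [StepWeights.kernel, h]

open Classical in
lemma hitProb_succ (n : ℕ) (x : ℤ × ℤ) : hitProb Γ w k (n + 1) (some x) =
    if x ∈ Γ.right then 0 else ∑ y ∈ StepWeights.neighbors x,
      (if Γ.Adj x y then w.step x y else 0) * hitProb Γ w k n (some y) := by
  rw [hitProb]
  simp only [Option.some.injEq, exists_eq_right']
  congr 1
  rw [tsum_eq_sum (s := (StepWeights.neighbors x).map Function.Embedding.some), Finset.sum_map]
  · rfl
  · rintro (_ | y) hy
    · rw [hitProb_none, mul_zero]
    · rw [kernel_of_not_adj, zero_mul]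
      intro hadj
      exact hy (Finset.mem_map_of_mem _ (StripGraph.Adj.mem_neighbors (G := Γ.toStripGraph) hadj))

lemma hitProb_succ_of_fst_eq (n : ℕ) (j : ℤ) : hitProb Γ w k (n + 1) (some (m, j)) = 0 := by
  rw [hitProb_succ]
  split_ifs with h
  · rfl
  · refine Finset.sum_eq_zero fun y _ => ?_
    have : ¬ Γ.Adj (m, j) y := fun hadj =>
      h ⟨StripGraph.Adj.mem_left (G := Γ.toStripGraph) hadj, rfl⟩
    simp [this]

lemma hitProb_nonneg_le_one (hw : w.IsTransition Γ) (n : ℕ) :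
    ∀ x, 0 ≤ hitProb Γ w k n (some x) ∧ hitProb Γ w k n (some x) ≤ 1 := by
  classical
  induction n with
  | zero =>
    intro x
    rw [hitProb]
    split_ifs <;> simp
  | succ n ih =>
    intro x
    rw [hitProb_succ]
    split_ifs with hR
    · simp
    by_cases hx : x ∈ Γ.points
    · refine ⟨Finset.sum_nonneg fun y _ => mul_nonneg ?_ (ih y).1, ?_⟩
      · split_ifs
        exacts [step_nonneg hw hx y, le_rfl]
      · refine le_trans (Finset.sum_le_sum fun y _ => ?_) (sum_step_eq_one hw hx).le
        have h1 := step_nonneg hw hx y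
        split_ifs
        · exact mul_le_of_le_one_right h1 (ih y).2
        · rwa [zero_mul]
    · rw [Finset.sum_eq_zero]
      · simp
      · intro y _
        have : ¬ Γ.Adj x y := fun hadj => hx (StripGraph.Adj.mem_left (G := Γ.toStripGraph) hadj)
        simp [this]

lemma hitProb_of_notMem (hk : (m, k) ∈ Γ.points) (n : ℕ) {x : ℤ × ℤ} (hx : x ∉ Γ.points) :
    hitProb Γ w k n (some x) = 0 := by
  classical
  cases n with
  | zero =>
    rw [hitProb, if_neg]
    rintro h
    rw [Option.some.inj h] at hx
    exact hx hk
  | succ n =>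
    rw [hitProb_succ]
    split_ifs
    · rfl
    · refine Finset.sum_eq_zero fun y _ => ?_
      have : ¬ Γ.Adj x y := fun hadj => hx (StripGraph.Adj.mem_left (G := Γ.toStripGraph) hadj)
      simp [this]

/-! ### The discounted hitting probability -/

variable (Γ w k) in
/-- The probability that the absorbed walk started at `x` first visits the right side at `(m, k)`,
when the walk survives each step with probability `r`. -/
noncomputable def discountedHit (r : ℝ) (x : ℤ × ℤ) : ℝ := ∑' n, hitProb Γ w k n (some x) * r ^ n

lemma summable_discountedHit (hw : w.IsTransition Γ) {r : ℝ} (hr : 0 ≤ r) (hr1 : r < 1)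
    (x : ℤ × ℤ) : Summable fun n => hitProb Γ w k n (some x) * r ^ n :=
  Summable.of_nonneg_of_le
    (fun n => mul_nonneg (hitProb_nonneg_le_one hw n x).1 (pow_nonneg hr n))
    (fun n => mul_le_of_le_one_left (pow_nonneg hr n) (hitProb_nonneg_le_one hw n x).2)
    (summable_geometric_of_lt_one hr hr1)

lemma discountedHit_nonneg (hw : w.IsTransition Γ) {r : ℝ} (hr : 0 ≤ r) (x : ℤ × ℤ) :
    0 ≤ discountedHit Γ w k r x :=
  tsum_nonneg fun n => mul_nonneg (hitProb_nonneg_le_one hw n x).1 (pow_nonneg hr n)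

lemma discountedHit_boundary (r : ℝ) (j : ℤ) :
    discountedHit Γ w k r (m, j) = if j = k then 1 else 0 := by
  rw [discountedHit, tsum_eq_single 0]
  · simp [hitProb]
  · rintro (_ | n) hn
    · exact absurd rfl hn
    · rw [hitProb_succ_of_fst_eq, zero_mul]

lemma discountedHit_harmonic (hw : w.IsTransition Γ) (hk : (m, k) ∈ Γ.points) {r : ℝ}
    (hr : 0 ≤ r) (hr1 : r < 1) :
    IsDiscountedHarmonic Γ.toStripGraph w.step r (discountedHit Γ w k r) where
  bdd := by
    refine ⟨∑' n : ℕ, r ^ n, fun x => ?_⟩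
    rw [abs_of_nonneg (discountedHit_nonneg hw hr x)]
    exact (summable_discountedHit hw hr hr1 x).tsum_le_tsum
      (fun n => mul_le_of_le_one_left (pow_nonneg hr n) (hitProb_nonneg_le_one hw n x).2)
      (summable_geometric_of_lt_one hr hr1)
  supp x hx := by
    refine (tsum_congr fun n => ?_).trans tsum_zero
    rw [hitProb_of_notMem hk n hx, zero_mul]
  eq x hx := by
    classical
    have hR : x ∉ Γ.right := fun h => hx h.2
    have h0 : hitProb Γ w k 0 (some x) = 0 := by
      rw [hitProb, if_neg]
      rintro h
      rw [Option.some.inj h] at hx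
      exact hx rfl
    simp only [discountedHit]
    rw [(summable_discountedHit hw hr hr1 x).tsum_eq_zero_add, h0, zero_mul, zero_add]
    simp only [hitProb_succ, if_neg hR, Finset.sum_mul]
    rw [Summable.tsum_finsetSum, Finset.mul_sum]
    · refine Finset.sum_congr rfl fun y _ => ?_
      rw [← tsum_mul_left, ← tsum_mul_left]
      refine tsum_congr fun n => ?_
      simp only [Region.toStripGraph_adj]
      ring
    · intro y _
      refine ((summable_discountedHit (k := k) hw hr hr1 y).mul_left
        (r * if Γ.Adj x y then w.step x y else 0)).congr fun n => ?_
      ring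

open Classical in
variable (Γ w) in
/-- Step probabilities that agree with `w` along the edges of `Γ`, and with the translate of `w`
along the edges of the translate of `Γ` by `(0, 1)`. -/
noncomputable def unionStep (x y : ℤ × ℤ) : ℝ :=
  if Γ.Adj x y then w.step x y
  else if Γ.toStripGraph.shift.Adj x y then w.step (x.1, x.2 - 1) (y.1, y.2 - 1) else 0

lemma unionStep_shift (hinv : w.YInvariant Γ) {x y : ℤ × ℤ}
    (h : Γ.toStripGraph.shift.Adj x y) :
    unionStep Γ w x y = w.step (x.1, x.2 - 1) (y.1, y.2 - 1) := by
  rw [unionStep]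
  split_ifs with h'
  · exact (step_shift hinv (StripGraph.Adj.mem_left (G := Γ.toStripGraph) h') h.mem_left y).symm
  · rfl

lemma unionStep_nonneg (hw : w.IsTransition Γ) (x y : ℤ × ℤ) : 0 ≤ unionStep Γ w x y := by
  rw [unionStep]
  split_ifs with h h'
  · exact step_nonneg hw (StripGraph.Adj.mem_left (G := Γ.toStripGraph) h) y
  · exact step_nonneg hw h'.mem_left _
  · rfl

/-- By `y`-invariance, `w` and its translate agree at the points common to `Γ` and its translate, so
that `unionStep` is still substochastic. -/
lemma sum_unionStep_le_one (hw : w.IsTransition Γ) (hinv : w.YInvariant Γ) (x : ℤ × ℤ) :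
    ∑ y ∈ StepWeights.neighbors x, unionStep Γ w x y ≤ 1 := by
  by_cases hx : x ∈ Γ.points
  · rw [← sum_step_eq_one hw hx]
    refine Finset.sum_le_sum fun y _ => ?_
    rw [unionStep]
    split_ifs with h h'
    · rfl
    · exact (step_shift hinv hx h'.mem_left y).le
    · exact step_nonneg hw hx y
  have hnot : ∀ y, ¬ Γ.Adj x y := fun y h =>
    hx (StripGraph.Adj.mem_left (G := Γ.toStripGraph) h)
  by_cases hx' : (x.1, x.2 - 1) ∈ Γ.points
  · have hsum : ∑ y ∈ StepWeights.neighbors x, w.step (x.1, x.2 - 1) (y.1, y.2 - 1) = 1 := by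
      rw [← sum_step_eq_one hw hx']
      exact sum_neighbors_shift (w.step (x.1, x.2 - 1)) x
    rw [← hsum]
    refine Finset.sum_le_sum fun y _ => ?_
    rw [unionStep, if_neg (hnot y)]
    split_ifs
    · rfl
    · exact step_nonneg hw hx' _
  · refine le_of_eq_of_le (Finset.sum_eq_zero fun y _ => ?_) zero_le_one
    rw [unionStep, if_neg (hnot y), if_neg fun h => hx' h.mem_left]

/-- Only the weights along the edges of the graph matter, so `w.step` may be replaced by
`unionStep`. -/
lemma IsDiscountedHarmonic.unionStep {r : ℝ} {f : ℤ × ℤ → ℝ}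
    (hf : IsDiscountedHarmonic Γ.toStripGraph w.step r f) :
    IsDiscountedHarmonic Γ.toStripGraph (unionStep Γ w) r f where
  bdd := hf.bdd
  supp := hf.supp
  eq x hx := by
    rw [hf.eq x hx]
    congr 1
    refine Finset.sum_congr rfl fun y _ => ?_
    split_ifs with h
    · rw [LatticeExit.unionStep, if_pos (Γ.toStripGraph_adj.1 h)]
    · rfl

lemma IsDiscountedHarmonic.shift (hinv : w.YInvariant Γ) {r : ℝ} {f : ℤ × ℤ → ℝ}
    (hf : IsDiscountedHarmonic Γ.toStripGraph w.step r f) :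
    IsDiscountedHarmonic Γ.toStripGraph.shift (LatticeExit.unionStep Γ w) r
      (fun x => f (x.1, x.2 - 1)) where
  bdd := by
    obtain ⟨B, hB⟩ := hf.bdd
    exact ⟨B, fun x => hB _⟩
  supp x hx := hf.supp _ hx
  eq x hx := by
    classical
    rw [hf.eq (x.1, x.2 - 1) hx, ← sum_neighbors_shift (fun y =>
      (if Γ.toStripGraph.Adj (x.1, x.2 - 1) y then w.step (x.1, x.2 - 1) y else 0) * f y)]
    congr 1
    refine Finset.sum_congr rfl fun y _ => ?_
    simp only [StripGraph.shift_adj]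
    split_ifs with h
    · rw [unionStep_shift hinv (StripGraph.shift_adj.2 h)]
    · rfl

/-- Log-concavity of the discounted exit probabilities. -/
lemma discountedHit_mul_le (hm : 0 < m) (hw : w.IsTransition Γ) (hinv : w.YInvariant Γ)
    (hk₁ : (m, k + 1) ∈ Γ.points) (hk₂ : (m, k - 1) ∈ Γ.points) {r : ℝ} (hr : 0 ≤ r)
    (hr1 : r < 1) :
    discountedHit Γ w (k + 1) r (0, 0) * discountedHit Γ w (k - 1) r (0, 0) ≤
      discountedHit Γ w k r (0, 0) ^ 2 := by
  by_contra! hlt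
  have hk := Γ.points_convex m (k - 1) k (k + 1) (by omega) (by omega) hk₂ hk₁
  have h₁ := discountedHit_harmonic hw hk₁ hr hr1
  have h₀ := discountedHit_harmonic hw hk hr hr1
  have h₂ := discountedHit_harmonic hw hk₂ hr hr1
  have n₁ := discountedHit_nonneg (k := k + 1) hw hr (0, 0)
  have n₀ := discountedHit_nonneg (k := k) hw hr (0, 0)
  have n₂ := discountedHit_nonneg (k := k - 1) hw hr (0, 0)
  -- The coefficients `a`, `b` are chosen so that
  -- `a * p (k + 1) - b * p k = p (k + 1) * p (k - 1) - p k ^ 2 = -(a * p k - b * p (k - 1))`.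
  set p₁ := discountedHit Γ w (k + 1) r (0, 0)
  set p₀ := discountedHit Γ w k r (0, 0)
  set p₂ := discountedHit Γ w (k - 1) r (0, 0)
  have ha : 0 ≤ p₀ + p₂ := by positivity
  have hb : 0 ≤ p₁ + p₀ := by positivity
  refine (h₁.linComb h₀ (p₀ + p₂) (p₁ + p₀)).unionStep.not_pos_neg
    ((h₀.linComb h₂ (p₀ + p₂) (p₁ + p₀)).shift hinv) Γ.points_convex Γ.containsHEdge_convex hr hr1
    (unionStep_nonneg hw) (sum_unionStep_le_one hw hinv) hm (b := k + 1) (b' := k) (a := 0)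
    (a' := 1) ?_ (by omega) ?_ ?_ zero_le_one ?_ ?_
  · intro j
    have e1 : j - 1 = k ↔ j = k + 1 := by omega
    have e2 : j - 1 = k - 1 ↔ j = k := by omega
    simp only [discountedHit_boundary, e1, e2]
  · intro j hj
    by_contra hne
    simp only [discountedHit_boundary, if_neg hne] at hj
    split_ifs at hj <;> linarith
  · intro j hj
    by_contra hne
    simp only [discountedHit_boundary, if_neg hne] at hj
    split_ifs at hj <;> linarith
  · change 0 < (p₀ + p₂) * p₁ - (p₁ + p₀) * p₀
    linarith
  · change (p₀ + p₂) * p₀ - (p₁ + p₀) * p₂ < 0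
    linarith

end Hitting

/-! ### The law of the exit point -/

open MeasureTheory Filter Topology

lemma hasSum_measureReal_iUnion {Ω ι : Type*} [MeasurableSpace Ω] [Countable ι] (μ : Measure Ω)
    [IsFiniteMeasure μ] {s : ι → Set Ω} (hs : ∀ i, MeasurableSet (s i))
    (hd : Pairwise (Function.onFun Disjoint s)) :
    HasSum (fun i => μ.real (s i)) (μ.real (⋃ i, s i)) := by
  have h := measure_iUnion (μ := μ) hd hs
  have hfin : ∑' i, μ (s i) ≠ ⊤ := h ▸ measure_ne_top μ _
  have := ENNReal.hasSum_toReal hfin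
  rwa [← ENNReal.tsum_toReal_eq fun i => measure_ne_top μ _, ← h] at this

namespace IsAbsorbedWalk

variable {m : ℤ} {Γ : Region m} {w : StepWeights} {Ω : Type*} [MeasurableSpace Ω]
  {μ : Measure Ω} {X : ℕ → Ω → Option (ℤ × ℤ)}

lemma measurableSet_mem (hX : IsAbsorbedWalk Γ w μ X) (t : ℕ) (S : Set (Option (ℤ × ℤ))) :
    MeasurableSet {ω | X t ω ∈ S} := by
  have : {ω | X t ω ∈ S} = ⋃ s ∈ S, {ω | X t ω = s} := by
    ext ω
    simp
  rw [this]
  exact MeasurableSet.biUnion S.to_countable fun s _ => hX.measurable t s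

lemma measurableSet_firstHit (hX : IsAbsorbedWalk Γ w μ X) (T : ℕ) (o : Option (ℤ × ℤ)) :
    MeasurableSet {ω | (∀ t < T, ¬ ∃ q ∈ Γ.right, X t ω = some q) ∧ X T ω = o} := by
  have : {ω | (∀ t < T, ¬ ∃ q ∈ Γ.right, X t ω = some q) ∧ X T ω = o} =
      (⋂ t, ⋂ _ : t < T, {ω | X t ω ∈ {s | ¬ ∃ q ∈ Γ.right, s = some q}}) ∩ {ω | X T ω = o} := by
    ext ω
    simp
  rw [this]
  exact (MeasurableSet.iInter fun t => MeasurableSet.iInter fun _ =>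
    hX.measurableSet_mem t _).inter (hX.measurable T o)

/-- The Markov property for the first visit to the right side, given the first `n` steps. -/
lemma measureReal_cylinder_firstHit [IsProbabilityMeasure μ] (hX : IsAbsorbedWalk Γ w μ X) {k : ℤ}
    (s : ℕ) :
    ∀ (n : ℕ) (x : ℕ → Option (ℤ × ℤ)), (∀ t < n, ¬ ∃ q ∈ Γ.right, x t = some q) →
      μ.real ({ω | ∀ t ≤ n, X t ω = x t} ∩
        {ω | (∀ t < n + s, ¬ ∃ q ∈ Γ.right, X t ω = some q) ∧ X (n + s) ω = some (m, k)}) =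
      μ.real {ω | ∀ t ≤ n, X t ω = x t} * hitProb Γ w k s (x n) := by
  induction s with
  | zero =>
    intro n x hx
    rw [hitProb]
    split_ifs with h
    · rw [mul_one]
      congr 1
      refine Set.inter_eq_left.2 fun ω hω => ⟨fun t ht => ?_, (hω n le_rfl).trans h⟩
      rw [hω t (by omega)]
      exact hx t ht
    · rw [mul_zero, ← measureReal_empty (μ := μ)]
      congr 1
      refine Set.eq_empty_of_forall_notMem fun ω hω => h ?_
      rw [← hω.1 n le_rfl]
      exact hω.2.2
  | succ s ih =>
    intro n x hx
    rw [hitProb]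
    split_ifs with h
    · rw [mul_zero, ← measureReal_empty (μ := μ)]
      congr 1
      refine Set.eq_empty_of_forall_notMem fun ω hω => hω.2.1 n (by omega) ?_
      rwa [hω.1 n le_rfl]
    -- Condition on the value `y` of `X (n + 1)`.
    have hcyl : ∀ y, {ω | ∀ t ≤ n + 1, X t ω = Function.update x (n + 1) y t} =
        {ω | ∀ t ≤ n, X t ω = x t} ∩ {ω | X (n + 1) ω = y} := by
      intro y
      ext ω
      constructor
      · intro hω
        refine ⟨fun t ht => ?_, by simpa using hω (n + 1) le_rfl⟩
        rw [hω t (by omega), Function.update_of_ne (by omega)]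
      · rintro ⟨h1, h2⟩ t ht
        rcases Nat.lt_or_ge n t with h3 | h3
        · obtain rfl : t = n + 1 := by omega
          simpa using h2
        · rw [Function.update_of_ne (by omega)]
          exact h1 t h3
    have hmeas : ∀ n (x : ℕ → Option (ℤ × ℤ)), MeasurableSet {ω | ∀ t ≤ n, X t ω = x t} := by
      intro n x
      have : {ω | ∀ t ≤ n, X t ω = x t} = ⋂ t, ⋂ _ : t ≤ n, {ω | X t ω = x t} := by
        ext ω
        simp
      rw [this]
      exact MeasurableSet.iInter fun t => MeasurableSet.iInter fun _ => hX.measurable t _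
    have hsum := hasSum_measureReal_iUnion μ
      (s := fun y => {ω | ∀ t ≤ n + 1, X t ω = Function.update x (n + 1) y t} ∩
        {ω | (∀ t < n + 1 + s, ¬ ∃ q ∈ Γ.right, X t ω = some q) ∧
          X (n + 1 + s) ω = some (m, k)})
      (fun y => (hmeas _ _).inter (hX.measurableSet_firstHit _ _))
      (fun y z hyz => Set.disjoint_left.2 fun ω hω hω' => hyz (by
        simpa using (hω.1 (n + 1) le_rfl).symm.trans (hω'.1 (n + 1) le_rfl)))
    have hU : (⋃ y, {ω | ∀ t ≤ n + 1, X t ω = Function.update x (n + 1) y t} ∩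
        {ω | (∀ t < n + 1 + s, ¬ ∃ q ∈ Γ.right, X t ω = some q) ∧
          X (n + 1 + s) ω = some (m, k)}) = {ω | ∀ t ≤ n, X t ω = x t} ∩
        {ω | (∀ t < n + (s + 1), ¬ ∃ q ∈ Γ.right, X t ω = some q) ∧
          X (n + (s + 1)) ω = some (m, k)} := by
      rw [← Set.iUnion_inter, show n + 1 + s = n + (s + 1) by omega]
      congr 1
      ext ω
      simp [hcyl]
    rw [hU] at hsum
    rw [← hsum.tsum_eq, ← tsum_mul_left]
    refine tsum_congr fun y => ?_
    rw [ih (n + 1) (Function.update x (n + 1) y), Function.update_self, hX.law, hX.law,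
      Finset.prod_range_succ, Function.update_self, Function.update_of_ne (by omega),
      Function.update_of_ne (by omega)]
    · rw [Finset.prod_congr rfl fun t ht => ?_, mul_assoc, mul_assoc, mul_assoc]
      have := Finset.mem_range.1 ht
      rw [Function.update_of_ne (by omega), Function.update_of_ne (by omega)]
    · intro t ht
      rw [Function.update_of_ne (by omega)]
      rcases Nat.lt_succ_iff_lt_or_eq.1 ht with ht | rfl
      · exact hx t ht
      · exact h

lemma measureReal_firstHit [IsProbabilityMeasure μ] (hX : IsAbsorbedWalk Γ w μ X) (k : ℤ)
    (T : ℕ) :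
    μ.real {ω | (∀ t < T, ¬ ∃ q ∈ Γ.right, X t ω = some q) ∧ X T ω = some (m, k)} =
      hitProb Γ w k T (some (0, 0)) := by
  have hsum := hasSum_measureReal_iUnion μ
    (s := fun y => {ω | ∀ t ≤ 0, X t ω = y} ∩
      {ω | (∀ t < 0 + T, ¬ ∃ q ∈ Γ.right, X t ω = some q) ∧ X (0 + T) ω = some (m, k)})
    (fun y => MeasurableSet.inter (by simpa using hX.measurable 0 y)
      (hX.measurableSet_firstHit _ _))
    (fun y z hyz => Set.disjoint_left.2 fun ω hω hω' =>
      hyz ((hω.1 0 le_rfl).symm.trans (hω'.1 0 le_rfl)))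
  rw [← Set.iUnion_inter, zero_add, Set.iUnion_eq_univ_iff.2 fun ω => ⟨X 0 ω, by simp⟩,
    Set.univ_inter] at hsum
  rw [← hsum.tsum_eq, tsum_eq_single (some (0, 0))]
  · have h1 := hX.measureReal_cylinder_firstHit (k := k) T 0 (fun _ => some (0, 0)) (by simp)
    rw [hX.law, zero_add] at h1
    simpa using h1
  · intro y hy
    have h1 := hX.measureReal_cylinder_firstHit (k := k) T 0 (fun _ => y) (by simp)
    rw [hX.law, zero_add, if_neg hy, zero_mul, zero_mul] at h1
    exact h1

/-- The exit probability as a sum over the time of the first visit to the right side. -/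
lemma hasSum_exitProb [IsProbabilityMeasure μ] (hX : IsAbsorbedWalk Γ w μ X) {k : ℤ}
    (hk : (m, k) ∈ Γ.right) :
    HasSum (fun n => hitProb Γ w k n (some (0, 0))) (exitProb Γ μ X k) := by
  have hsum := hasSum_measureReal_iUnion μ
    (s := fun T => {ω | (∀ t < T, ¬ ∃ q ∈ Γ.right, X t ω = some q) ∧ X T ω = some (m, k)})
    (fun T => hX.measurableSet_firstHit T _)
    (fun T T' hT => Set.disjoint_left.2 fun ω hω hω' => by
      rcases lt_or_gt_of_ne hT with h | h
      · exact hω'.1 T h ⟨_, hk, hω.2⟩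
      · exact hω.1 T' h ⟨_, hk, hω'.2⟩)
  simp only [hX.measureReal_firstHit] at hsum
  convert hsum using 2
  rw [exitProb]
  congr 1
  ext ω
  simp only [Set.mem_ofPred_eq, Set.mem_iUnion]
  refine exists_congr fun T => ⟨fun h => ⟨fun t ht h' => ?_, h.2⟩, fun h => ⟨⟨?_, ?_⟩, h.2⟩⟩
  · exact (h.1.2 h').not_gt ht
  · exact ⟨_, hk, h.2⟩
  · intro t ht
    by_contra hlt
    exact h.1 t (not_le.1 hlt) ht

/-- Abel's limit theorem removes the discount. -/
lemma tendsto_discountedHit [IsProbabilityMeasure μ] (hX : IsAbsorbedWalk Γ w μ X) {k : ℤ}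
    (hk : (m, k) ∈ Γ.right) :
    Tendsto (fun r => discountedHit Γ w k r (0, 0)) (𝓝[<] 1) (𝓝 (exitProb Γ μ X k)) :=
  Real.tendsto_tsum_powerSeries_nhdsWithin_lt (hX.hasSum_exitProb hk).tendsto_sum_nat

end IsAbsorbedWalk

end LatticeExit

theorem theorem4p1 {m : ℤ} (hm : 0 < m) (Γ : LatticeExit.Region m)
    (hO : ((0, 0) : ℤ × ℤ) ∈ Γ.left)
    (w : LatticeExit.StepWeights) (hw : w.IsTransition Γ) (hinv : w.YInvariant Γ)
    {Ω : Type*} [MeasurableSpace Ω] (μ : MeasureTheory.Measure Ω)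
    [MeasureTheory.IsProbabilityMeasure μ]
    (X : ℕ → Ω → Option (ℤ × ℤ)) (hX : LatticeExit.IsAbsorbedWalk Γ w μ X)
    (k : ℤ) (hk₁ : (m, k + 1) ∈ Γ.right) (hk₂ : (m, k - 1) ∈ Γ.right) :
    LatticeExit.exitProb Γ μ X (k + 1) * LatticeExit.exitProb Γ μ X (k - 1) ≤
      LatticeExit.exitProb Γ μ X k ^ 2 := by
  have hk : (m, k) ∈ Γ.right :=
    ⟨Γ.points_convex m (k - 1) k (k + 1) (by omega) (by omega) hk₂.1 hk₁.1, rfl⟩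
  refine le_of_tendsto_of_tendsto
    ((hX.tendsto_discountedHit hk₁).mul (hX.tendsto_discountedHit hk₂))
    ((hX.tendsto_discountedHit hk).pow 2) ?_
  filter_upwards [Ioo_mem_nhdsLT (zero_lt_one (α := ℝ))] with r hr
  exact LatticeExit.discountedHit_mul_le hm hw hinv hk₁.1 hk₂.1 hr.1.le hr.2
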